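/- Let $E,F$ be complex vector spaces and let $\langle\cdot,\cdot\rangle:F\times E\to\mathbb C$ be an anti-duality, i.e. a map that is linear in the first and conjugate linear in the second variable and separates the points of $F$ and of $E$. Let $\sigma(E,F)$ and $\sigma(F,E)$ be the corresponding weak topologies on $E$ and $F$, and assume that $F$ is $\sigma(F,E)$-sequentially complete. Call a linear operator $T:E\to E$ weakly continuous if it is $\sigma(E,F)$-$\sigma(E,F)$ continuous; its adjoint $T^*:F\to F$ is then the linear operator determined by $\langle T^*f,x\rangle=\langle f,Tx\rangle$ for all $f\in F$, $x\in E$. Let $A:\operatorname{dom}A\to F$ be a subpositive operator: a linear operator defined on a linear subspace $\operatorname{dom}A$ of $E$ such that for every $y\in E$ there is $M_y\ge 0$ with $$|\langle Ax,y\rangle|^2\le M_y\langle Ax,x\rangle\qquad\text{for all }x\in\operatorname{dom}A .$$ Its Krein–von Neumann extension $A_N:E\to F$ is defined as follows. Let $H_A$ be the Hilbert space completion of $\operatorname{ran}A$ with respect to the inner product $(Ax\,|\,Ax')_A:=\langle Ax,x'\rangle$, $x,x'\in\operatorname{dom}A$. Let $J:H_A\to F$ be the weakly continuous extension to $H_A$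 of the embedding $\operatorname{ran}A\hookrightarrow F$, so that for each $y\in E$ the functional $h\mapsto\langle Jh,y\rangle$ is the continuous extension to $H_A$ of $Ax\mapsto\langle Ax,y\rangle$. Let $J^*:E\to H_A$ be its adjoint, $(h\,|\,J^*y)_A=\langle Jh,y\rangle$ for $h\in H_A$, $y\in E$. Then $A_N:=JJ^*$. **Theorem.** Let $B,C:E\to E$ be weakly continuous linear operators that leave $\operatorname{dom}A$ invariant. Assume that the spectrum of the restriction $BC|_{\operatorname{dom}A}$, taken in the algebra of all linear operators on $\operatorname{dom}A$ that are continuous for the topology inherited from $\sigma(E,F)$, is a bounded subset of $\mathbb C$. Assume also that $$C^*A\subset AB\qquad\text{and}\qquad B^*A\subset AC ,$$ where $\subset$ denotes inclusion of partially defined operators and each product has its natural domain. Then $$C^*A_N=A_NB\qquad\text{and}\qquad B^*A_N=A_NC .$$ -/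

import Mathlib

open scoped ComplexOrder Topology

/-- An anti-duality between the complex vector spaces `F` and `E`: a sesquilinear map
`⟨f, x⟩`, linear in `f` and conjugate linear in `x`, separating the points of both spaces. -/
structure AntiDualPair (F E : Type*) [AddCommGroup F] [Module ℂ F] [AddCommGroup E]
    [Module ℂ E] where
  pairing : F →ₗ[ℂ] E →ₗ⋆[ℂ] ℂ
  eq_zero_left : ∀ f : F, (∀ x : E, pairing f x = 0) → f = 0
  eq_zero_right : ∀ x : E, (∀ f : F, pairing f x = 0) → x = 0

namespace AntiDualPair

noncomputable section

variable {F E : Type*} [AddCommGroup F] [Module ℂ F] [AddCommGroup E] [Module ℂ E]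

/-! ### Weak topologies -/

/-- The weak topology `σ(E, F)`: the coarsest topology on `E` for which `x ↦ ⟨f, x⟩` is
continuous for every `f : F`. -/
@[reducible] def weakTopology (P : AntiDualPair F E) : TopologicalSpace E :=
  TopologicalSpace.induced (fun x f => P.pairing f x) Pi.topologicalSpace

/-- The uniform structure of the weak topology `σ(F, E)` on `F`, that is, the coarsest one for
which `f ↦ ⟨f, x⟩` is uniformly continuous for every `x : E`. -/
@[reducible] def weakStarUniformSpace (P : AntiDualPair F E) : UniformSpace F :=
  UniformSpace.comap (fun f x => P.pairing f x) (Pi.uniformSpace fun _ : E => ℂ)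

/-- `F` is `σ(F, E)`-sequentially complete: every `σ(F, E)`-Cauchy sequence is
`σ(F, E)`-convergent. -/
def WeakStarSeqComplete (P : AntiDualPair F E) : Prop :=
  letI := P.weakStarUniformSpace
  ∀ u : ℕ → F, CauchySeq u → ∃ f : F, Filter.Tendsto u Filter.atTop (nhds f)

/-- `σ(E, F)`-`σ(E, F)` continuity of a linear operator on `E`. -/
def WeaklyContinuous (P : AntiDualPair F E) (T : E →ₗ[ℂ] E) : Prop :=
  Continuous[P.weakTopology, P.weakTopology] T

/-- The topology which a subspace `D` of `E` inherits from `σ(E, F)`. -/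
@[reducible] def weakTopologyOn (P : AntiDualPair F E) (D : Submodule ℂ E) : TopologicalSpace D :=
  TopologicalSpace.induced ((↑) : D → E) P.weakTopology

lemma continuous_pairing (P : AntiDualPair F E) (D : Submodule ℂ E) (f : F) :
    Continuous[P.weakTopologyOn D, inferInstance] fun x : D => P.pairing f x := by
  let _ := P.weakTopologyOn D
  let _ := P.weakTopology
  have h1 : Continuous fun x : E => fun f => P.pairing f x := continuous_induced_dom
  have h2 : Continuous ((↑) : D → E) := continuous_induced_dom
  exact (continuous_apply f).comp (h1.comp h2)

lemma continuous_weakTopologyOn_iff (P : AntiDualPair F E) (D : Submodule ℂ E)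
    {X : Type*} [TopologicalSpace X] (g : X → D) :
    Continuous[inferInstance, P.weakTopologyOn D] g ↔
      ∀ f : F, Continuous fun t => P.pairing f (g t) := by
  let _ := P.weakTopologyOn D
  let _ := P.weakTopology
  constructor
  · intro h f
    exact (P.continuous_pairing D f).comp h
  · intro h
    refine continuous_induced_rng.2 (continuous_induced_rng.2 (continuous_pi_iff.2 h))

/-- The algebra `ℒ(D)` of all linear operators on a subspace `D` of `E` that are continuous for
the topology inherited from `σ(E, F)`. -/
def weakEnd (P : AntiDualPair F E) (D : Submodule ℂ E) : Subalgebra ℂ (Module.End ℂ D) where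
  carrier := {T | Continuous[P.weakTopologyOn D, P.weakTopologyOn D] T}
  mul_mem' := by
    intro S T hS hT
    let _ := P.weakTopologyOn D
    exact Continuous.comp (g := S) (f := T) hS hT
  add_mem' := by
    intro S T hS hT
    let _ := P.weakTopologyOn D
    refine (P.continuous_weakTopologyOn_iff D _).2 fun f => ?_
    have h1 := (P.continuous_weakTopologyOn_iff D _).1 hS f
    have h2 := (P.continuous_weakTopologyOn_iff D _).1 hT f
    simpa [Pi.add_def] using h1.add h2
  algebraMap_mem' := by
    intro c
    let _ := P.weakTopologyOn D
    refine (P.continuous_weakTopologyOn_iff D _).2 fun f => ?_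
    simpa [Module.algebraMap_end_apply, Pi.smul_def] using
      (P.continuous_pairing D f).const_smul (starRingEnd ℂ c)

lemma restrict_mem_weakEnd (P : AntiDualPair F E) {T : E →ₗ[ℂ] E} (hT : P.WeaklyContinuous T)
    {D : Submodule ℂ E} (hD : ∀ x ∈ D, T x ∈ D) : T.restrict hD ∈ P.weakEnd D := by
  change Continuous[P.weakTopologyOn D, P.weakTopologyOn D] (T.restrict hD)
  let _ := P.weakTopologyOn D
  let _ := P.weakTopology
  have h2 : Continuous ((↑) : D → E) := continuous_induced_dom
  exact continuous_induced_rng.2 (Continuous.comp (g := T) hT h2)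

/-- The restriction to an invariant subspace `D` of a weakly continuous operator `T` on `E`,
as an element of the algebra `ℒ(D)`. -/
def restrict (P : AntiDualPair F E) (T : E →ₗ[ℂ] E) (hT : P.WeaklyContinuous T)
    (D : Submodule ℂ E) (hD : ∀ x ∈ D, T x ∈ D) : P.weakEnd D :=
  ⟨T.restrict hD, P.restrict_mem_weakEnd hT hD⟩

lemma WeaklyContinuous.comp {P : AntiDualPair F E} {S T : E →ₗ[ℂ] E} (hS : P.WeaklyContinuous S)
    (hT : P.WeaklyContinuous T) : P.WeaklyContinuous (S ∘ₗ T) := by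
  let _ := P.weakTopology
  exact Continuous.comp (g := S) (f := T) hS hT

/-! ### Adjoints -/

lemma exists_adjoint_apply (P : AntiDualPair F E) {T : E →ₗ[ℂ] E} (hT : P.WeaklyContinuous T)
    (f : F) : ∃ g : F, ∀ x : E, P.pairing g x = P.pairing f (T x) := by
  let toFunctional : F →ₗ⋆[ℂ] (E →ₗ[ℂ] ℂ) :=
    { toFun := fun g =>
        { toFun := fun x => starRingEnd ℂ (P.pairing g x)
          map_add' := by intros; simp
          map_smul' := by intros; simp }
      map_add' := by intros; ext; simp
      map_smul' := by intros; ext; simp }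
  let φ : E →ₗ[ℂ] ℂ := (toFunctional f) ∘ₗ T
  let t : TopologicalSpace E := ⨅ g : F, TopologicalSpace.induced (toFunctional g) inferInstance
  have hle : t ≤ P.weakTopology := by
    refine continuous_iff_le_induced.1 (continuous_pi_iff.2 fun g => ?_)
    have h4 : Continuous (toFunctional g) := continuous_iInf_dom continuous_induced_dom
    have h5 : Continuous fun x => starRingEnd ℂ (toFunctional g x) :=
      Complex.continuous_conj.comp h4
    simpa [toFunctional] using h5
  have hcont : Continuous[t, inferInstance] φ := by
    refine continuous_le_dom hle ?_
    let _ := P.weakTopology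
    have h1 : Continuous fun x : E => fun f => P.pairing f x := continuous_induced_dom
    have h2 : Continuous fun x : E => P.pairing f (T x) :=
      (continuous_apply f).comp (h1.comp hT)
    exact Complex.continuous_conj.comp h2
  have hmem := (LinearMap.mem_span_iff_continuous (f := fun g => toFunctional g) φ).2 hcont
  have hspan : Submodule.span ℂ (Set.range fun g => toFunctional g) =
      LinearMap.range toFunctional := by
    have : (Set.range fun g => toFunctional g) = (LinearMap.range toFunctional : Set _) := rfl
    rw [this, Submodule.span_eq]
  rw [hspan] at hmem
  obtain ⟨g, hg⟩ := hmem
  refine ⟨g, fun x => ?_⟩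
  have := LinearMap.congr_fun hg x
  exact (starRingEnd ℂ).injective this

lemma ext_left (P : AntiDualPair F E) {f g : F} (h : ∀ x, P.pairing f x = P.pairing g x) :
    f = g :=
  sub_eq_zero.1 (P.eq_zero_left _ fun x => by simp [h x])

/-- The adjoint `T* : F → F` of a weakly continuous operator `T` on `E`, determined by
`⟨T* f, x⟩ = ⟨f, T x⟩`. -/
def adjoint (P : AntiDualPair F E) (T : E →ₗ[ℂ] E) (hT : P.WeaklyContinuous T) : F →ₗ[ℂ] F where
  toFun f := (P.exists_adjoint_apply hT f).choose
  map_add' f g := P.ext_left fun x => by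
    rw [(P.exists_adjoint_apply hT (f + g)).choose_spec, map_add, map_add, LinearMap.add_apply,
      LinearMap.add_apply, (P.exists_adjoint_apply hT f).choose_spec,
      (P.exists_adjoint_apply hT g).choose_spec]
  map_smul' c f := P.ext_left fun x => by
    rw [(P.exists_adjoint_apply hT (c • f)).choose_spec, RingHom.id_apply, map_smul, map_smul,
      LinearMap.smul_apply, LinearMap.smul_apply, (P.exists_adjoint_apply hT f).choose_spec]

lemma adjoint_pairing (P : AntiDualPair F E) (T : E →ₗ[ℂ] E) (hT : P.WeaklyContinuous T)
    (f : F) (x : E) : P.pairing (P.adjoint T hT f) x = P.pairing f (T x) :=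
  (P.exists_adjoint_apply hT f).choose_spec x

/-- The product `A B` of a partially defined operator `A` with an operator `B`, on its natural
domain `{x | B x ∈ dom A}`. -/
def compRight (A : E →ₗ.[ℂ] F) (B : E →ₗ[ℂ] E) : E →ₗ.[ℂ] F where
  domain := A.domain.comap B
  toFun := A.toFun ∘ₗ B.restrict (fun _ hx => hx)

/-! ### Subpositive operators and the Krein–von Neumann extension -/

/-- `A : dom A → F` is subpositive if for every `y : E` there is `M ≥ 0` such that
`|⟨A x, y⟩|² ≤ M ⟨A x, x⟩` for all `x ∈ dom A`. The order is that of `ℂ`, so that the inequality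
says in particular that the right-hand side is real. -/
def Subpositive (P : AntiDualPair F E) (A : E →ₗ.[ℂ] F) : Prop :=
  ∀ y : E, ∃ M : ℝ, 0 ≤ M ∧
    ∀ x : A.domain, ((‖P.pairing (A x) y‖ ^ 2 : ℝ) : ℂ) ≤ (M : ℂ) * P.pairing (A x) x

variable {P : AntiDualPair F E} {A : E →ₗ.[ℂ] F}

lemma Subpositive.nonneg (hA : P.Subpositive A) (x : A.domain) : 0 ≤ P.pairing (A x) x := by
  obtain ⟨M, hM, h⟩ := hA x
  have hx := h x
  rcases hM.eq_or_lt with rfl | hM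
  · have h0 : P.pairing (A x) x = 0 := by
      have : (‖P.pairing (A x) x‖ ^ 2 : ℝ) ≤ 0 := by
        rw [Complex.ofReal_zero, zero_mul] at hx
        exact_mod_cast hx
      have := pow_eq_zero_iff (two_ne_zero) |>.1 (le_antisymm this (sq_nonneg _))
      simpa using this
    exact h0.ge
  · have h1 : (0 : ℂ) ≤ (M : ℂ) * P.pairing (A x) x :=
      le_trans (by exact_mod_cast sq_nonneg ‖P.pairing (A x) x‖) hx
    have h2 : (0 : ℂ) < (M : ℂ) := by exact_mod_cast hM
    exact le_of_mul_le_mul_left (by simpa using h1) h2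

lemma Subpositive.conj_pairing (hA : P.Subpositive A) (x y : A.domain) :
    starRingEnd ℂ (P.pairing (A y) x) = P.pairing (A x) y := by
  have hr : ∀ z : A.domain, (P.pairing (A z) z).im = 0 := fun z =>
    ((Complex.le_def.1 (hA.nonneg z)).2).symm
  have h1 := hr (x + y)
  have h2 := hr (x + Complex.I • y)
  have hx := hr x
  have hy := hr y
  simp only [LinearPMap.map_add, LinearPMap.map_smul, Submodule.coe_add, Submodule.coe_smul,
    map_add, LinearMap.add_apply, map_smul, LinearMap.smul_apply, map_smulₛₗ, Complex.conj_I,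
    smul_eq_mul, Complex.add_im, Complex.mul_im, Complex.mul_re, Complex.add_re, Complex.I_re, Complex.I_im,
    Complex.neg_re, Complex.neg_im] at h1 h2
  apply Complex.ext
  · simp only [Complex.conj_re]; linarith
  · simp only [Complex.conj_im]; linarith

/-- The range of a subpositive operator `A`, as a space that will carry the inner product
`(A x | A x')_A = ⟨A x, x'⟩`. -/
def EnergyRange (P : AntiDualPair F E) (A : E →ₗ.[ℂ] F) (_hA : P.Subpositive A) : Type _ :=
  LinearMap.range A.toFun

instance (hA : P.Subpositive A) : AddCommGroup (EnergyRange P A hA) :=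
  inferInstanceAs (AddCommGroup (LinearMap.range A.toFun))

instance (hA : P.Subpositive A) : Module ℂ (EnergyRange P A hA) :=
  inferInstanceAs (Module ℂ (LinearMap.range A.toFun))

/-- The inclusion `ran A → F`. -/
def EnergyRange.incl (hA : P.Subpositive A) : EnergyRange P A hA →ₗ[ℂ] F :=
  (LinearMap.range A.toFun).subtype

/-- The element `A x` of `ran A`. -/
def EnergyRange.mk (hA : P.Subpositive A) (x : A.domain) : EnergyRange P A hA :=
  ⟨A x, LinearMap.mem_range_self A.toFun x⟩

/-- A vector of `dom A` which `A` maps to the given element of `ran A`. -/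
def EnergyRange.lift {hA : P.Subpositive A} (u : EnergyRange P A hA) : A.domain :=
  (LinearMap.mem_range.1 u.2).choose

lemma EnergyRange.apply_lift {hA : P.Subpositive A} (u : EnergyRange P A hA) :
    A u.lift = incl hA u :=
  (LinearMap.mem_range.1 u.2).choose_spec

lemma EnergyRange.pairing_lift {hA : P.Subpositive A} (v : EnergyRange P A hA)
    (u : EnergyRange P A hA) :
    P.pairing (incl hA v) u.lift = starRingEnd ℂ (P.pairing (incl hA u) v.lift) := by
  rw [← v.apply_lift, ← u.apply_lift, hA.conj_pairing]

/-- The inner product `(A x | A x')_A = ⟨A x, x'⟩` on `ran A`. Mathlib's `inner ℂ u v` is conjugate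
linear in `u`, so it stands for `(v | u)_A`. -/
@[reducible] def EnergyRange.core (hA : P.Subpositive A) :
    InnerProductSpace.Core ℂ (EnergyRange P A hA) where
  inner u v := P.pairing (incl hA v) u.lift
  conj_inner_symm u v := by
    rw [EnergyRange.pairing_lift, Complex.conj_conj]
  re_inner_nonneg u := by
    rw [← u.apply_lift]
    exact (Complex.le_def.1 (hA.nonneg u.lift)).1
  add_left u v w := by
    simp only [EnergyRange.pairing_lift w, map_add, LinearMap.add_apply]
  smul_left u v r := by
    simp only [EnergyRange.pairing_lift v, map_smul, LinearMap.smul_apply, smul_eq_mul, map_mul]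
  definite u hu := by
    rw [← u.apply_lift] at hu
    have h0 : A u.lift = 0 := by
      refine P.eq_zero_left _ fun y => ?_
      obtain ⟨M, -, h⟩ := hA y
      have h1 := h u.lift
      rw [hu, mul_zero] at h1
      have h2 : (‖P.pairing (A u.lift) y‖ ^ 2 : ℝ) ≤ 0 := by exact_mod_cast h1
      have h3 := pow_eq_zero_iff (two_ne_zero) |>.1 (le_antisymm h2 (sq_nonneg _))
      simpa using h3
    rw [u.apply_lift] at h0
    exact Subtype.ext h0

instance (hA : P.Subpositive A) : NormedAddCommGroup (EnergyRange P A hA) :=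
  (EnergyRange.core hA).toNormedAddCommGroup

instance (hA : P.Subpositive A) : InnerProductSpace ℂ (EnergyRange P A hA) :=
  InnerProductSpace.ofCore (EnergyRange.core hA).toCore

lemma EnergyRange.inner_mk (hA : P.Subpositive A) (x x' : A.domain) :
    inner ℂ (mk hA x') (mk hA x) = P.pairing (A x) x' := by
  change P.pairing (A x) (mk hA x').lift = _
  rw [← hA.conj_pairing, EnergyRange.apply_lift, ← hA.conj_pairing x x']
  rfl

/-- The Hilbert space `H_A`, the completion of `ran A`. -/
abbrev EnergySpace (P : AntiDualPair F E) (A : E →ₗ.[ℂ] F) (hA : P.Subpositive A) : Type _ :=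
  UniformSpace.Completion (EnergyRange P A hA)

lemma exists_energy_bound (hA : P.Subpositive A) (y : E) :
    ∃ C : ℝ, ∀ u : EnergyRange P A hA, ‖P.pairing (EnergyRange.incl hA u) y‖ ≤ C * ‖u‖ := by
  obtain ⟨M, hM, h⟩ := hA y
  refine ⟨Real.sqrt M, fun u => ?_⟩
  have h1 := (Complex.le_def.1 (h u.lift)).1
  have h2 : ‖u‖ ^ 2 = (P.pairing (A u.lift) u.lift).re := by
    rw [← inner_self_eq_norm_sq (𝕜 := ℂ), u.apply_lift]
    rfl
  rw [Complex.ofReal_re, Complex.re_ofReal_mul, ← h2, u.apply_lift] at h1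
  refine abs_le_of_sq_le_sq' ?_ (by positivity) |>.2
  rw [mul_pow, Real.sq_sqrt hM]
  exact h1

/-- The functional `A x ↦ ⟨A x, y⟩` on `ran A`, which is continuous for the inner product
`(· | ·)_A`. -/
def rangeFunctional (hA : P.Subpositive A) (y : E) : EnergyRange P A hA →L[ℂ] ℂ :=
  LinearMap.mkContinuousOfExistsBound
    { toFun := fun u => P.pairing (EnergyRange.incl hA u) y
      map_add' := fun u v => by simp
      map_smul' := fun c u => by simp } (exists_energy_bound hA y)

/-- The continuous extension of `A x ↦ ⟨A x, y⟩` to `H_A`. -/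
def energyFunctional (hA : P.Subpositive A) (y : E) : EnergySpace P A hA →L[ℂ] ℂ :=
  (rangeFunctional hA y).extend UniformSpace.Completion.toComplL

lemma energyFunctional_coe (hA : P.Subpositive A) (y : E) (u : EnergyRange P A hA) :
    energyFunctional hA y (u : EnergySpace P A hA) = P.pairing (EnergyRange.incl hA u) y :=
  ContinuousLinearMap.extend_eq (e := UniformSpace.Completion.toComplL) (rangeFunctional hA y)
    UniformSpace.Completion.denseRange_coe
    (UniformSpace.Completion.isUniformInducing_coe _) u

lemma energyFunctional_ext (hA : P.Subpositive A) {φ ψ : EnergySpace P A hA → ℂ}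
    (hφ : Continuous φ) (hψ : Continuous ψ) (h : ∀ u : EnergyRange P A hA, φ u = ψ u) : φ = ψ :=
  UniformSpace.Completion.ext hφ hψ h

lemma energyFunctional_add (hA : P.Subpositive A) (y z : E) :
    energyFunctional hA (y + z) = energyFunctional hA y + energyFunctional hA z :=
  DFunLike.coe_injective <| energyFunctional_ext hA (energyFunctional hA (y + z)).continuous
    (energyFunctional hA y + energyFunctional hA z).continuous fun u => by
      simp [energyFunctional_coe]

lemma energyFunctional_smul (hA : P.Subpositive A) (c : ℂ) (y : E) :
    energyFunctional hA (c • y) = starRingEnd ℂ c • energyFunctional hA y :=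
  DFunLike.coe_injective <| energyFunctional_ext hA (energyFunctional hA (c • y)).continuous
    (starRingEnd ℂ c • energyFunctional hA y).continuous fun u => by
      simp [energyFunctional_coe]

lemma exists_energyEmbedding_apply (hP : P.WeakStarSeqComplete) (hA : P.Subpositive A)
    (h : EnergySpace P A hA) :
    ∃ f : F, ∀ y : E, P.pairing f y = energyFunctional hA y h := by
  obtain ⟨u, hu⟩ : ∃ u : ℕ → EnergyRange P A hA,
      Filter.Tendsto (fun n => (u n : EnergySpace P A hA)) Filter.atTop (nhds h) := by
    obtain ⟨v, hv, hvh⟩ := mem_closure_iff_seq_limit.1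
      (UniformSpace.Completion.denseRange_coe (α := EnergyRange P A hA) h)
    choose u hu using hv
    exact ⟨u, by simpa only [hu] using hvh⟩
  have hlim : ∀ y : E, Filter.Tendsto (fun n => P.pairing (EnergyRange.incl hA (u n)) y)
      Filter.atTop (nhds (energyFunctional hA y h)) := fun y => by
    simpa only [energyFunctional_coe, Function.comp_def] using
      ((energyFunctional hA y).continuous.tendsto h).comp hu
  let _ := P.weakStarUniformSpace
  have hcau : CauchySeq fun n => EnergyRange.incl hA (u n) := by
    have hind : IsUniformInducing fun (f : F) (x : E) => P.pairing f x := ⟨rfl⟩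
    refine hind.cauchy_map_iff.1 ?_
    exact (tendsto_pi_nhds.2 hlim).cauchySeq
  obtain ⟨f, hf⟩ := hP _ hcau
  have hc : Continuous fun (f : F) (x : E) => P.pairing f x :=
    (show IsUniformInducing fun (f : F) (x : E) => P.pairing f x from ⟨rfl⟩).uniformContinuous.continuous
  refine ⟨f, fun y => tendsto_nhds_unique ?_ (hlim y)⟩
  exact (tendsto_pi_nhds.1 ((hc.tendsto f).comp hf)) y

/-- The continuous extension `J : H_A → F` of the embedding `ran A ⊆ F`: the element `J h` is
determined by the requirement that, for each `y`, `⟨J h, y⟩` is the value at `h` of the continuous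
extension of `A x ↦ ⟨A x, y⟩`. -/
def energyEmbedding (hP : P.WeakStarSeqComplete) (hA : P.Subpositive A) :
    EnergySpace P A hA →ₗ[ℂ] F where
  toFun h := (exists_energyEmbedding_apply hP hA h).choose
  map_add' h k := P.ext_left fun y => by
    rw [(exists_energyEmbedding_apply hP hA (h + k)).choose_spec, map_add, map_add,
      LinearMap.add_apply, (exists_energyEmbedding_apply hP hA h).choose_spec,
      (exists_energyEmbedding_apply hP hA k).choose_spec]
  map_smul' c h := P.ext_left fun y => by
    rw [(exists_energyEmbedding_apply hP hA (c • h)).choose_spec, RingHom.id_apply, map_smul,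
      map_smul, LinearMap.smul_apply, (exists_energyEmbedding_apply hP hA h).choose_spec]

lemma energyEmbedding_pairing (hP : P.WeakStarSeqComplete) (hA : P.Subpositive A)
    (h : EnergySpace P A hA) (y : E) :
    P.pairing (energyEmbedding hP hA h) y = energyFunctional hA y h :=
  (exists_energyEmbedding_apply hP hA h).choose_spec y

/-- The adjoint `J* : E → H_A`, determined by `(h | J* y)_A = ⟨J h, y⟩` (through the Riesz
representation of the functional `h ↦ ⟨J h, y⟩`). -/
def energyAdjoint (hA : P.Subpositive A) : E →ₗ[ℂ] EnergySpace P A hA where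
  toFun y := (InnerProductSpace.toDual ℂ (EnergySpace P A hA)).symm (energyFunctional hA y)
  map_add' y z := by rw [energyFunctional_add, map_add]
  map_smul' c y := by
    rw [energyFunctional_smul, LinearIsometryEquiv.map_smulₛₗ, Complex.conj_conj,
      RingHom.id_apply]

lemma inner_energyAdjoint (hP : P.WeakStarSeqComplete) (hA : P.Subpositive A)
    (h : EnergySpace P A hA) (y : E) :
    inner ℂ (energyAdjoint hA y) h = P.pairing (energyEmbedding hP hA h) y := by
  rw [energyEmbedding_pairing]
  exact InnerProductSpace.toDual_symm_apply

/-- The Krein–von Neumann extension `A_N = J J*` of a subpositive operator `A`. -/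
def kreinVonNeumann (hP : P.WeakStarSeqComplete) (hA : P.Subpositive A) : E →ₗ[ℂ] F :=
  energyEmbedding hP hA ∘ₗ energyAdjoint hA

end

end AntiDualPair

/-! ### Self-adjoint operators and ranges of their translates -/

/-! The inclusions say that `C*` and `B*` leave `ran A` invariant, acting there by `A x ↦ A (B x)`
and `A x ↦ A (C x)`. Call these restrictions `S` and `T`. They are adjoint to each other for the
energy inner product, because `⟨C* A x, y⟩ = ⟨A x, C y⟩`. If both are bounded, they extend to `H_A`,
where `J S = C* J` and `J T = B* J`. The adjoint of the latter is `S J* = J* B`, hence `C* J J* = J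
S J* = J J* B`; the second identity is symmetric (`adjoint_comp_kreinVonNeumann`).

The point is boundedness. Since `‖T u‖² = (S T u | u)_A`, it is enough to bound the positive
symmetric operator `K = S T`, which sends `A x` to `A (B C x)`. The spectral hypothesis is purely
algebraic: it makes `s - K` map `ran A` onto itself for all large real `s`. As `ran A` need not be
complete, this gives no bound directly. However, the inverse of `a + K` is a contraction for large
`a` and extends to a self-adjoint `G` on `H_A`. Surjectivity of `s - K` for all large `|s|` puts the
dense space `ran A` inside the range of `s - G` for every small real `s`, and
`isUnit_of_dense_subset_ranges` makes `G` invertible. So `a + K` is bounded.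

That last step is spectral. If `u = (s - G) v`, the spectral measure of `u` is very thin near `s`.
Were it nonzero near 0, repeated halving would find a point `s` near which it is too thick for this.
Tent functions of `G` replace the spectral measure. -/

/-- For `0 ≤ δ` this is an equality of piecewise linear functions with nodes `δ / 2` apart. The
weights 1, 2, 1 add up to 4, the loss factor of one halving. -/
lemma tent_le_sum_tents (c δ t : ℝ) :
    max 0 (δ - |t - c|) ≤ max 0 (δ / 2 - |t - (c - δ / 2)|) + 2 * max 0 (δ / 2 - |t - c|) +
      max 0 (δ / 2 - |t - (c + δ / 2)|) := by
  have h1 := le_max_left 0 (δ / 2 - |t - (c - δ / 2)|)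
  have h2 := le_max_left 0 (δ / 2 - |t - c|)
  have h3 := le_max_left 0 (δ / 2 - |t - (c + δ / 2)|)
  have h1' := le_max_right 0 (δ / 2 - |t - (c - δ / 2)|)
  have h2' := le_max_right 0 (δ / 2 - |t - c|)
  have h3' := le_max_right 0 (δ / 2 - |t - (c + δ / 2)|)
  refine max_le (by positivity) ?_
  rcases abs_cases (t - (c - δ / 2)) with ⟨e1, _⟩ | ⟨e1, _⟩ <;>
  rcases abs_cases (t - c) with ⟨e2, _⟩ | ⟨e2, _⟩ <;>
  rcases abs_cases (t - (c + δ / 2)) with ⟨e3, _⟩ | ⟨e3, _⟩ <;>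
  linarith

/-- On the support of the tent `|s - t| ≤ 2 * δ`, and the tent itself is at most `δ`. -/
lemma mul_tent_mul_le {c δ s : ℝ} (h : |c - s| ≤ δ) (t : ℝ) :
    (s - t) * max 0 (δ - |t - c|) * (s - t) ≤ 4 * δ ^ 3 := by
  have hδ : 0 ≤ δ := (abs_nonneg _).trans h
  rcases le_total (δ - |t - c|) 0 with h0 | h0
  · rw [max_eq_left h0]
    simp only [mul_zero, zero_mul]
    positivity
  · rw [max_eq_right h0]
    have h1 : |s - t| ≤ 2 * δ := by
      have := abs_sub_le s c t
      rw [abs_sub_comm s c, abs_sub_comm c t] at this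
      linarith
    have h2 : (s - t) ^ 2 ≤ (2 * δ) ^ 2 := sq_le_sq' (abs_le.1 h1).1 (abs_le.1 h1).2
    have h3 : δ - |t - c| ≤ δ := by linarith [abs_nonneg (t - c)]
    calc (s - t) * (δ - |t - c|) * (s - t) = (δ - |t - c|) * (s - t) ^ 2 := by ring
      _ ≤ δ * (2 * δ) ^ 2 := mul_le_mul h3 h2 (sq_nonneg _) hδ
      _ = 4 * δ ^ 3 := by ring

/-! ### Spectral localisation with tent functions -/

section Hilbert

variable {H : Type*} [NormedAddCommGroup H] [InnerProductSpace ℂ H] [CompleteSpace H]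

lemma re_inner_cfc_mono (G : H →L[ℂ] H) {f g : ℝ → ℝ} (hf : Continuous f)
    (hg : Continuous g) (hfg : ∀ t, f t ≤ g t) (u : H) :
    (inner ℂ (cfc f G u) u).re ≤ (inner ℂ (cfc g G u) u).re := by
  have h : cfc f G ≤ cfc g G :=
    cfc_mono (fun t _ => hfg t) hf.continuousOn hg.continuousOn
  have h1 := ((ContinuousLinearMap.le_def _ _).1 h).re_inner_nonneg_left u
  simp only [sub_apply, inner_sub_left, map_sub, RCLike.re_to_complex] at h1
  linarith

/-- Pigeonhole: one of the three half-width tents, whose weights have sum 4, carries at least a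
quarter of the mass. -/
lemma exists_smaller_tent (G : H →L[ℂ] H) (u : H) (c : ℝ) {δ : ℝ} (hδ : 0 ≤ δ) :
    ∃ c', |c - c'| ≤ δ / 2 ∧
      (inner ℂ (cfc (fun t : ℝ => max 0 (δ - |t - c|)) G u) u).re / 4 ≤
        (inner ℂ (cfc (fun t : ℝ => max 0 (δ / 2 - |t - c'|)) G u) u).re := by
  let f : ℝ → ℝ → ℝ := fun c' t => max 0 (δ / 2 - |t - c'|)
  have hf : ∀ c', Continuous (f c') := fun c' => by fun_prop
  have h := re_inner_cfc_mono G (f := fun t => max 0 (δ - |t - c|))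
    (g := fun t => f (c - δ / 2) t + 2 * f c t + f (c + δ / 2) t) (by fun_prop)
    (((hf _).add (continuous_const.mul (hf _))).add (hf _)) (tent_le_sum_tents c δ) u
  by_cases hG : IsSelfAdjoint G
  · rw [cfc_add (a := G) (fun t => f (c - δ / 2) t + 2 * f c t) (f (c + δ / 2))
        ((hf _).add (continuous_const.mul (hf _))).continuousOn (hf _).continuousOn,
      cfc_add (a := G) (f (c - δ / 2)) (fun t => 2 * f c t) (hf _).continuousOn
        (continuous_const.mul (hf _)).continuousOn,
      cfc_const_mul 2 (f c) G (hf _).continuousOn] at h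
    simp only [add_apply, smul_apply, inner_add_left,
      Complex.add_re, inner_smul_left_eq_smul, Complex.smul_re,
      smul_eq_mul] at h
    by_contra! hcon
    have h1 := hcon (c - δ / 2) (by rw [sub_sub_cancel, abs_of_nonneg (by linarith)])
    have h2 := hcon c (by simpa using by linarith)
    have h3 := hcon (c + δ / 2) (by rw [sub_add_cancel_left, abs_neg, abs_of_nonneg (by linarith)])
    simp only [f] at h
    linarith
  -- Without self-adjointness `cfc` takes its default value 0, and any centre works.
  · exact ⟨c, by simpa using by linarith, by simp [cfc_apply_of_not_predicate G hG]⟩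

/-- Moving one factor `s - G` across the inner product leaves the function `(s - t) * tent * (s -
t)` of `G`, evaluated at `v`. The cubic order in `δ` is what matters, since it beats the factor 4
lost in each halving. -/
lemma re_inner_tent_le {G : H →L[ℂ] H} (hG : IsSelfAdjoint G) {c δ s : ℝ} (h : |c - s| ≤ δ)
    (v : H) :
    (inner ℂ (cfc (fun t : ℝ => max 0 (δ - |t - c|)) G (s • v - G v)) (s • v - G v)).re ≤
      4 * δ ^ 3 * ‖v‖ ^ 2 := by
  let f : ℝ → ℝ := fun t => max 0 (δ - |t - c|)
  have hf : Continuous f := by fun_prop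
  have hT : cfc (fun t : ℝ => s - t) G = algebraMap ℝ _ s - G := by
    rw [cfc_sub (a := G) (fun _ => s) (fun t => t), cfc_const s G, cfc_id' ℝ G]
  have hTv : cfc (fun t : ℝ => s - t) G v = s • v - G v := by
    rw [hT, sub_apply, Algebra.algebraMap_eq_smul_one]
    rfl
  have hmul : cfc (fun t : ℝ => (s - t) * f t * (s - t)) G =
      cfc (fun t : ℝ => s - t) G * cfc f G * cfc (fun t : ℝ => s - t) G := by
    rw [cfc_mul (a := G) (fun t => (s - t) * f t) (fun t => s - t), cfc_mul (a := G) (fun t => s - t) f]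
  have hle := re_inner_cfc_mono G (f := fun t => (s - t) * f t * (s - t))
    (g := fun _ => 4 * δ ^ 3) (by fun_prop) continuous_const (mul_tent_mul_le h) v
  have hsa : IsSelfAdjoint (cfc (fun t : ℝ => s - t) G) := cfc_predicate _ _
  rw [hmul, cfc_const _ G, mul_apply_eq_comp, mul_apply_eq_comp,
    ← ContinuousLinearMap.adjoint_inner_right, hsa.adjoint_eq, hTv,
    Algebra.algebraMap_eq_smul_one, smul_apply,
    one_apply_eq_self, inner_smul_left_eq_smul, Complex.smul_re, smul_eq_mul,
    show (inner ℂ v v).re = ‖v‖ ^ 2 from inner_self_eq_norm_sq (𝕜 := ℂ) v] at hle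
  exact hle

/-- The preimage `v` depends on `s` with no uniform bound, so the halving procedure first selects a
single bad `s`, the limit of the centres, and only then uses its `v`. -/
lemma re_inner_tent_nonpos {G : H →L[ℂ] H} (hG : IsSelfAdjoint G) {ρ : ℝ} (hρ : 0 ≤ ρ) {u : H}
    (hu : ∀ s : ℝ, |s| ≤ ρ → ∃ v : H, s • v - G v = u) :
    (inner ℂ (cfc (fun t : ℝ => max 0 (ρ - |t|)) G u) u).re ≤ 0 := by
  let q : ℝ → ℝ → ℝ := fun c δ =>
    (inner ℂ (cfc (fun t : ℝ => max 0 (δ - |t - c|)) G u) u).re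
  choose g hg hgq using fun (n : ℕ) (c : ℝ) =>
    exists_smaller_tent G u c (show 0 ≤ ρ / 2 ^ n by positivity)
  let c : ℕ → ℝ := fun n => Nat.rec 0 (fun n x => g n x) n
  have hc0 : c 0 = 0 := rfl
  have hc : ∀ n, dist (c n) (c (n + 1)) ≤ ρ / 2 / 2 ^ n := fun n => by
    rw [div_right_comm]
    exact hg n (c n)
  obtain ⟨s, hs⟩ := cauchySeq_tendsto_of_complete (cauchySeq_of_le_geometric_two hc)
  have hcs : ∀ n, |c n - s| ≤ ρ / 2 ^ n := fun n =>
    dist_le_of_le_geometric_two_of_tendsto hc hs n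
  -- The centres start at 0, so the case `n = 0` of `hcs` says `|s| ≤ ρ`.
  obtain ⟨v, rfl⟩ := hu s (by simpa [hc0] using hcs 0)
  have hq : ∀ n, q 0 ρ / 4 ^ n ≤ q (c n) (ρ / 2 ^ n) := fun n => by
    induction n with
    | zero => simp [hc0]
    | succ n ih =>
      have h1 : q (c n) (ρ / 2 ^ n) / 4 ≤ q (c (n + 1)) (ρ / 2 ^ n / 2) := hgq n (c n)
      rw [div_div, ← pow_succ] at h1
      rw [pow_succ, ← div_div]
      linarith
  -- The mass is at least `q 0 ρ / 4 ^ n` and at most a constant times `1 / 8 ^ n`.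
  have hbound : ∀ n : ℕ, q 0 ρ ≤ 4 * ρ ^ 3 * ‖v‖ ^ 2 * (1 / 2) ^ n := fun n => by
    have h1 := (hq n).trans (re_inner_tent_le hG (hcs n) v)
    rw [div_le_iff₀ (by positivity)] at h1
    refine h1.trans_eq ?_
    have h4 : (4 : ℝ) ^ n = 2 ^ n * 2 ^ n := by rw [← mul_pow]; norm_num
    rw [h4, one_div, inv_pow]
    field_simp
  have hlim := (tendsto_pow_atTop_nhds_zero_of_lt_one (r := (1 / 2 : ℝ)) (by norm_num)
    (by norm_num)).const_mul (4 * ρ ^ 3 * ‖v‖ ^ 2)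
  rw [mul_zero] at hlim
  simpa [q] using ge_of_tendsto' hlim hbound

/-- A self-adjoint operator `G` is invertible as soon as all `s - G` with small real `s` have a
common dense subset in their ranges. -/
lemma isUnit_of_dense_subset_ranges {G : H →L[ℂ] H} (hG : IsSelfAdjoint G) {ρ : ℝ} (hρ : 0 < ρ)
    {D : Set H} (hD : Dense D) (h : ∀ u ∈ D, ∀ s : ℝ, |s| ≤ ρ → ∃ v : H, s • v - G v = u) :
    IsUnit G := by
  have hcont : Continuous fun t : ℝ => max 0 (ρ - |t|) := by fun_prop
  have hsa : IsSelfAdjoint (cfc (fun t : ℝ => max 0 (ρ - |t|)) G) := cfc_predicate _ _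
  have hall : ∀ u, (inner ℂ (cfc (fun t : ℝ => max 0 (ρ - |t|)) G u) u).re ≤ 0 := fun u =>
    hD.induction (P := fun u => (inner ℂ (cfc (fun t : ℝ => max 0 (ρ - |t|)) G u) u).re ≤ 0)
      (fun u hu => re_inner_tent_nonpos hG hρ.le (h u hu))
      (isClosed_le (Complex.continuous_re.comp (by fun_prop)) continuous_const) u
  have hle : cfc (fun t : ℝ => max 0 (ρ - |t|)) G ≤ 0 := by
    rw [ContinuousLinearMap.le_def, zero_sub]
    refine (ContinuousLinearMap.isPositive_def' ).2 ⟨hsa.neg, fun u => ?_⟩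
    simpa [ContinuousLinearMap.reApplyInnerSelf_apply] using hall u
  -- The tent is now nonpositive on the spectrum, but its value at 0 is `ρ > 0`.
  rw [cfc_nonpos_iff _ _ hcont.continuousOn] at hle
  rw [← spectrum.zero_notMem_iff ℝ]
  intro h0
  have := hle 0 h0
  simp at this
  linarith

end Hilbert

/-! ### From surjectivity to boundedness without completeness -/

/-- A positive symmetric operator `K` on an inner product space (not assumed complete) is bounded
if `s - K` is onto for all real `s` outside a bounded set. -/
lemma exists_bound_of_surjective {D : Type*} [NormedAddCommGroup D] [InnerProductSpace ℂ D]
    (K : D →ₗ[ℂ] D) (hsymm : ∀ u v, inner ℂ (K u) v = inner ℂ u (K v))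
    (hpos : ∀ u, 0 ≤ (inner ℂ (K u) u).re) {r : ℝ} (hr : 0 ≤ r)
    (hsurj : ∀ s : ℝ, r < |s| → ∀ u, ∃ v, (s : ℂ) • v - K v = u) :
    ∃ M : ℝ, 0 ≤ M ∧ ∀ u, ‖K u‖ ≤ M * ‖u‖ := by
  -- The shift exceeds `r`, so `-a - K` is onto, and is at least 1, so the inverse of `a + K` is a
  -- contraction.
  let a : ℝ := r + 1
  have ha : 1 ≤ a := by simp [a, hr]
  let L : D →ₗ[ℂ] D := (a : ℂ) • LinearMap.id + K
  have hLapp : ∀ u, L u = (a : ℂ) • u + K u := fun u => rfl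
  have hLsymm : ∀ u v, inner ℂ (L u) v = inner ℂ u (L v) := fun u v => by
    rw [hLapp, hLapp, inner_add_left, inner_add_right, inner_smul_left, inner_smul_right,
      Complex.conj_ofReal, hsymm]
  have hLbound : ∀ u, ‖u‖ ≤ ‖L u‖ := fun u => by
    have h1 : ‖u‖ ^ 2 ≤ (inner ℂ (L u) u).re := by
      have h3 : (inner ℂ u u : ℂ) = ((‖u‖ ^ 2 : ℝ) : ℂ) := by
        rw [inner_self_eq_norm_sq_to_K]; simp
      rw [hLapp, inner_add_left, inner_smul_left, Complex.add_re, Complex.conj_ofReal,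
        Complex.re_ofReal_mul, h3, Complex.ofReal_re]
      nlinarith [hpos u, sq_nonneg ‖u‖]
    have h2 : (inner ℂ (L u) u).re ≤ ‖L u‖ * ‖u‖ :=
      (Complex.re_le_norm _).trans (norm_inner_le_norm _ _)
    by_contra! hlt
    nlinarith [norm_nonneg u, norm_nonneg (L u)]
  have hLinj : Function.Injective L := (injective_iff_map_eq_zero L).2 fun u hu => by
    have := hLbound u
    rw [hu, norm_zero] at this
    exact norm_le_zero_iff.1 this
  have hLsurj : Function.Surjective L := fun u => by
    obtain ⟨v, hv⟩ := hsurj (-a) (by rw [abs_neg, abs_of_nonneg (by linarith)]; simp [a]) u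
    refine ⟨-v, ?_⟩
    rw [hLapp, ← hv, map_neg]
    push_cast
    module
  let e : D ≃ₗ[ℂ] D := LinearEquiv.ofBijective L ⟨hLinj, hLsurj⟩
  have he : ∀ u, L (e.symm u) = u := fun u => e.apply_symm_apply u
  let G₀ : D →L[ℂ] D := (e.symm : D →ₗ[ℂ] D).mkContinuous 1 fun u => by
    simpa [he] using hLbound (e.symm u)
  have hG₀L : ∀ u, G₀ (L u) = u := fun u => e.symm_apply_apply u
  let G : UniformSpace.Completion D →L[ℂ] UniformSpace.Completion D := G₀.completion
  have hGcoe : ∀ u : D, G u = (G₀ u : D) := fun u => ContinuousLinearMap.completion_apply_coe _ _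
  have hGsa : IsSelfAdjoint G := by
    rw [ContinuousLinearMap.isSelfAdjoint_iff_isSymmetric]
    intro x y
    refine UniformSpace.Completion.induction_on₂ x y
      (isClosed_eq (by simp only [ContinuousLinearMap.coe_coe]; fun_prop)
        (by simp only [ContinuousLinearMap.coe_coe]; fun_prop)) fun u v => ?_
    obtain ⟨u, rfl⟩ := hLsurj u
    obtain ⟨v, rfl⟩ := hLsurj v
    simp only [ContinuousLinearMap.coe_coe, hGcoe, hG₀L, UniformSpace.Completion.inner_coe, hLsymm]
  -- For `0 < |s| ≤ ρ` this gives `|s⁻¹ - a| ≥ 2 * (a + r) - a > r`.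
  let ρ : ℝ := (2 * (a + r))⁻¹
  have har : 0 < a + r := by linarith
  have hρ : 0 < ρ := by positivity
  have hunit : IsUnit G := by
    refine isUnit_of_dense_subset_ranges hGsa hρ
      (UniformSpace.Completion.denseRange_coe (α := D)) ?_
    rintro _ ⟨u, rfl⟩ s hs
    rcases eq_or_ne s 0 with rfl | hs0
    · refine ⟨((-L u : D) : UniformSpace.Completion D), ?_⟩
      rw [hGcoe, map_neg, hG₀L, zero_smul, zero_sub, ← UniformSpace.Completion.coe_neg, neg_neg]
    · have hspos : 0 < |s| := abs_pos.2 hs0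
      have hlarge : r < |s⁻¹ - a| := by
        have h1 : 2 * (a + r) ≤ |s|⁻¹ := (le_inv_comm₀ hspos (by positivity)).1 hs
        have h2 := abs_sub_abs_le_abs_sub s⁻¹ a
        rw [abs_inv, abs_of_nonneg (by linarith : 0 ≤ a)] at h2
        linarith
      -- Since `G L w = w`, solving `s • v - G v = u` with `v = L w` means `(L - s⁻¹) w = s⁻¹ • u`,
      -- an equation for `K` at the parameter `s⁻¹ - a`.
      obtain ⟨w, hw⟩ := hsurj (s⁻¹ - a) hlarge (-((s : ℂ)⁻¹ • u))
      refine ⟨((L w : D) : UniformSpace.Completion D), ?_⟩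
      rw [hGcoe, hG₀L, ← Complex.coe_smul, ← UniformSpace.Completion.coe_smul,
        ← UniformSpace.Completion.coe_sub]
      congr 1
      have hs' : (s : ℂ) ≠ 0 := by exact_mod_cast hs0
      have hK : K w = ((s : ℂ)⁻¹ - a) • w + (s : ℂ)⁻¹ • u := by
        push_cast at hw
        rw [sub_eq_iff_eq_add] at hw
        rw [hw]; abel
      rw [hLapp, hK]
      simp only [smul_add, sub_smul, smul_sub, smul_smul, mul_inv_cancel₀ hs', one_smul]
      abel
  obtain ⟨N, hN⟩ := hunit
  let R : UniformSpace.Completion D →L[ℂ] UniformSpace.Completion D := ↑N⁻¹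
  have hRG : ∀ x, R (G x) = x := fun x => by
    rw [← hN, ← mul_apply_eq_comp, Units.inv_mul, one_apply_eq_self]
  refine ⟨‖R‖ + a, by positivity, fun u => ?_⟩
  have h1 : ‖L u‖ ≤ ‖R‖ * ‖u‖ := by
    have := R.le_opNorm (G (L u : D))
    rwa [hRG, hGcoe, hG₀L, UniformSpace.Completion.norm_coe, UniformSpace.Completion.norm_coe]
      at this
  have h2 : K u = L u - (a : ℂ) • u := by rw [hLapp]; abel
  calc ‖K u‖ ≤ ‖L u‖ + ‖(a : ℂ) • u‖ := by rw [h2]; exact norm_sub_le _ _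
    _ ≤ ‖R‖ * ‖u‖ + a * ‖u‖ := by
      rw [norm_smul, Complex.norm_real, Real.norm_of_nonneg (by linarith : 0 ≤ a)]
      gcongr
    _ = (‖R‖ + a) * ‖u‖ := by ring

/-! ### Intertwining operators on the energy space -/

namespace AntiDualPair

variable {F E : Type*} [AddCommGroup F] [Module ℂ F] [AddCommGroup E] [Module ℂ E]
  {P : AntiDualPair F E} {A : E →ₗ.[ℂ] F}

/-- The operator induced on `ran A` by an operator on `F` which leaves `ran A` invariant. -/
noncomputable def EnergyRange.restrict (hA : P.Subpositive A) (T : F →ₗ[ℂ] F)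
    (hT : ∀ f ∈ LinearMap.range A.toFun, T f ∈ LinearMap.range A.toFun) :
    EnergyRange P A hA →ₗ[ℂ] EnergyRange P A hA :=
  T.restrict hT

lemma EnergyRange.incl_restrict (hA : P.Subpositive A) (T : F →ₗ[ℂ] F)
    (hT : ∀ f ∈ LinearMap.range A.toFun, T f ∈ LinearMap.range A.toFun)
    (u : EnergyRange P A hA) : incl hA (restrict hA T hT u) = T (incl hA u) :=
  rfl

lemma EnergyRange.restrict_mk (hA : P.Subpositive A) (T : F →ₗ[ℂ] F)
    (hT : ∀ f ∈ LinearMap.range A.toFun, T f ∈ LinearMap.range A.toFun)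
    {x y : A.domain} (h : T (A x) = A y) : restrict hA T hT (mk hA x) = mk hA y :=
  Subtype.ext h

lemma EnergyRange.exists_mk_eq (hA : P.Subpositive A) (u : EnergyRange P A hA) :
    ∃ x, mk hA x = u :=
  ⟨u.lift, Subtype.ext u.apply_lift⟩

lemma EnergyRange.sub_mk (hA : P.Subpositive A) (c : ℂ) (x y : A.domain) :
    c • mk hA x - mk hA y = mk hA (c • x - y) :=
  Subtype.ext (by
    change c • A x - A y = A (c • x - y)
    rw [LinearPMap.map_sub, LinearPMap.map_smul])

lemma adjoint_apply_of_compPMap_le {B C : E →ₗ[ℂ] E} {hC : P.WeaklyContinuous C}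
    (hBD : ∀ x ∈ A.domain, B x ∈ A.domain)
    (h : (P.adjoint C hC).compPMap A ≤ compRight A B) (x : A.domain) :
    P.adjoint C hC (A x) = A ⟨B x, hBD x x.2⟩ :=
  h.2 (x := x) (y := ⟨x, hBD x x.2⟩) rfl

lemma adjoint_mem_range_of_compPMap_le {B C : E →ₗ[ℂ] E} {hC : P.WeaklyContinuous C}
    (hBD : ∀ x ∈ A.domain, B x ∈ A.domain)
    (h : (P.adjoint C hC).compPMap A ≤ compRight A B) :
    ∀ f ∈ LinearMap.range A.toFun, P.adjoint C hC f ∈ LinearMap.range A.toFun := by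
  rintro _ ⟨x, rfl⟩
  exact ⟨⟨B x, hBD x x.2⟩, (adjoint_apply_of_compPMap_le hBD h x).symm⟩

/-- Both sides are continuous in `h` and agree on `ran A` by the definition of `C*`. This is the
weak form of `J S = C* J`. -/
lemma energyFunctional_completion (hA : P.Subpositive A) {C : E →ₗ[ℂ] E}
    {hC : P.WeaklyContinuous C} {S : EnergyRange P A hA →L[ℂ] EnergyRange P A hA}
    (hS : ∀ u, EnergyRange.incl hA (S u) = P.adjoint C hC (EnergyRange.incl hA u)) (y : E)
    (h : EnergySpace P A hA) :
    energyFunctional hA y (S.completion h) = energyFunctional hA (C y) h :=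
  congrFun (energyFunctional_ext hA (φ := fun h => energyFunctional hA y (S.completion h))
    (by fun_prop) (energyFunctional hA (C y)).continuous fun u => by
      rw [ContinuousLinearMap.completion_apply_coe, energyFunctional_coe, energyFunctional_coe, hS,
        adjoint_pairing]) h

lemma energyEmbedding_completion (hP : P.WeakStarSeqComplete) (hA : P.Subpositive A)
    {C : E →ₗ[ℂ] E} {hC : P.WeaklyContinuous C}
    {S : EnergyRange P A hA →L[ℂ] EnergyRange P A hA}
    (hS : ∀ u, EnergyRange.incl hA (S u) = P.adjoint C hC (EnergyRange.incl hA u))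
    (h : EnergySpace P A hA) :
    energyEmbedding hP hA (S.completion h) = P.adjoint C hC (energyEmbedding hP hA h) :=
  P.ext_left fun y => by
    rw [adjoint_pairing, energyEmbedding_pairing, energyEmbedding_pairing,
      energyFunctional_completion hA hS]

lemma inner_completion_left {D : Type*} [NormedAddCommGroup D] [InnerProductSpace ℂ D]
    {S T : D →L[ℂ] D} (hST : ∀ u v, inner ℂ (S u) v = inner ℂ u (T v))
    (x y : UniformSpace.Completion D) :
    inner ℂ (S.completion x) y = inner ℂ x (T.completion y) := by
  refine UniformSpace.Completion.induction_on₂ x y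
    (isClosed_eq (by fun_prop) (by fun_prop)) fun u v => ?_
  rw [ContinuousLinearMap.completion_apply_coe, ContinuousLinearMap.completion_apply_coe,
    UniformSpace.Completion.inner_coe, UniformSpace.Completion.inner_coe, hST]

/-- If the restrictions of `C*` and `B*` to `ran A` are bounded and adjoint to each other, then
`C*` and `B` intertwine the Krein–von Neumann extension. -/
lemma adjoint_comp_kreinVonNeumann (hP : P.WeakStarSeqComplete) (hA : P.Subpositive A)
    {B C : E →ₗ[ℂ] E} {hB : P.WeaklyContinuous B} {hC : P.WeaklyContinuous C}
    {S T : EnergyRange P A hA →L[ℂ] EnergyRange P A hA}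
    (hS : ∀ u, EnergyRange.incl hA (S u) = P.adjoint C hC (EnergyRange.incl hA u))
    (hT : ∀ u, EnergyRange.incl hA (T u) = P.adjoint B hB (EnergyRange.incl hA u))
    (hST : ∀ u v, inner ℂ (S u) v = inner ℂ u (T v)) :
    P.adjoint C hC ∘ₗ kreinVonNeumann hP hA = kreinVonNeumann hP hA ∘ₗ B := by
  -- This is `S J* = J* B`, the adjoint of `J T = B* J`.
  have hadj : ∀ y, S.completion (energyAdjoint hA y) = energyAdjoint hA (B y) := fun y => by
    refine ext_inner_right ℂ fun h => ?_
    rw [inner_completion_left hST, inner_energyAdjoint hP, inner_energyAdjoint hP,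
      energyEmbedding_completion hP hA hT, adjoint_pairing]
  ext y
  change P.adjoint C hC (energyEmbedding hP hA (energyAdjoint hA y)) =
    energyEmbedding hP hA (energyAdjoint hA (B y))
  rw [← hadj, energyEmbedding_completion hP hA hS]

end AntiDualPair

/-! ### Boundedness of the two restrictions and the main theorem -/

/-- Mutually adjoint operators `S` and `T` on an inner product space are bounded if `S T` is. -/
lemma exists_bounds_of_comp_bounded {D : Type*} [NormedAddCommGroup D] [InnerProductSpace ℂ D]
    {S T : D →ₗ[ℂ] D} (hST : ∀ u v, inner ℂ (S u) v = inner ℂ u (T v)) {M : ℝ} (hM : 0 ≤ M)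
    (hbound : ∀ u, ‖S (T u)‖ ≤ M * ‖u‖) :
    (∀ u, ‖S u‖ ≤ √M * ‖u‖) ∧ ∀ u, ‖T u‖ ≤ √M * ‖u‖ := by
  have hT : ∀ u, ‖T u‖ ≤ √M * ‖u‖ := fun u => by
    refine abs_le_of_sq_le_sq' ?_ (by positivity) |>.2
    rw [mul_pow, Real.sq_sqrt hM]
    calc ‖T u‖ ^ 2 = ‖inner ℂ (S (T u)) u‖ := by
          rw [hST, inner_self_eq_norm_sq_to_K]; simp
      _ ≤ ‖S (T u)‖ * ‖u‖ := norm_inner_le_norm _ _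
      _ ≤ M * ‖u‖ * ‖u‖ := by gcongr; exact hbound u
      _ = M * ‖u‖ ^ 2 := by ring
  refine ⟨fun u => ?_, hT⟩
  rcases (norm_nonneg (S u)).eq_or_lt with h0 | h0
  · rw [← h0]; positivity
  refine le_of_mul_le_mul_right ?_ h0
  calc ‖S u‖ * ‖S u‖ = ‖inner ℂ u (T (S u))‖ := by
        rw [← hST, inner_self_eq_norm_sq_to_K]; simp [sq]
    _ ≤ ‖u‖ * ‖T (S u)‖ := norm_inner_le_norm _ _
    _ ≤ ‖u‖ * (√M * ‖S u‖) := by gcongr; exact hT _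
    _ = √M * ‖u‖ * ‖S u‖ := by ring

lemma exists_smul_sub_apply_eq_of_notMem_spectrum {X : Type*} [AddCommGroup X] [Module ℂ X]
    {𝒜 : Subalgebra ℂ (Module.End ℂ X)} {T : 𝒜} {c : ℂ} (h : c ∉ spectrum ℂ T) (x : X) :
    ∃ z, c • z - (T : Module.End ℂ X) z = x := by
  obtain ⟨N, hN⟩ := spectrum.notMem_iff.1 h
  refine ⟨((↑N⁻¹ : 𝒜) : Module.End ℂ X) x, ?_⟩
  have h1 := congrArg (fun R : 𝒜 => (R : Module.End ℂ X) x) N.mul_inv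
  rw [hN] at h1
  simpa [Module.algebraMap_end_apply] using h1

theorem theorem3p3 {F E : Type*} [AddCommGroup F] [Module ℂ F] [AddCommGroup E] [Module ℂ E]
    (P : AntiDualPair F E) (hP : P.WeakStarSeqComplete)
    (A : E →ₗ.[ℂ] F) (hA : P.Subpositive A)
    (B C : E →ₗ[ℂ] E) (hB : P.WeaklyContinuous B) (hC : P.WeaklyContinuous C)
    (hBD : ∀ x ∈ A.domain, B x ∈ A.domain) (hCD : ∀ x ∈ A.domain, C x ∈ A.domain)
    (hspec : Bornology.IsBounded (spectrum ℂ
      (P.restrict (B ∘ₗ C) (hB.comp hC) A.domain fun x hx => hBD (C x) (hCD x hx))))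
    (hCA : (P.adjoint C hC).compPMap A ≤ AntiDualPair.compRight A B)
    (hBA : (P.adjoint B hB).compPMap A ≤ AntiDualPair.compRight A C) :
    P.adjoint C hC ∘ₗ AntiDualPair.kreinVonNeumann hP hA =
        AntiDualPair.kreinVonNeumann hP hA ∘ₗ B ∧
      P.adjoint B hB ∘ₗ AntiDualPair.kreinVonNeumann hP hA =
        AntiDualPair.kreinVonNeumann hP hA ∘ₗ C := by
  have hCA' := AntiDualPair.adjoint_apply_of_compPMap_le hBD hCA
  have hBA' := AntiDualPair.adjoint_apply_of_compPMap_le hCD hBA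
  let S := AntiDualPair.EnergyRange.restrict hA (P.adjoint C hC)
    (AntiDualPair.adjoint_mem_range_of_compPMap_le hBD hCA)
  let T := AntiDualPair.EnergyRange.restrict hA (P.adjoint B hB)
    (AntiDualPair.adjoint_mem_range_of_compPMap_le hCD hBA)
  have hS : ∀ x, S (AntiDualPair.EnergyRange.mk hA x) =
      AntiDualPair.EnergyRange.mk hA ⟨B x, hBD x x.2⟩ := fun x =>
    AntiDualPair.EnergyRange.restrict_mk hA _ _ (hCA' x)
  have hT : ∀ x, T (AntiDualPair.EnergyRange.mk hA x) =
      AntiDualPair.EnergyRange.mk hA ⟨C x, hCD x x.2⟩ := fun x =>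
    AntiDualPair.EnergyRange.restrict_mk hA _ _ (hBA' x)
  -- On `u = A x` and `v = A y` both sides equal `⟨A y, C x⟩`.
  have hTS : ∀ u v, inner ℂ (T u) v = inner ℂ u (S v) := fun u v => by
    obtain ⟨x, rfl⟩ := AntiDualPair.EnergyRange.exists_mk_eq hA u
    obtain ⟨y, rfl⟩ := AntiDualPair.EnergyRange.exists_mk_eq hA v
    rw [hS, hT, AntiDualPair.EnergyRange.inner_mk, AntiDualPair.EnergyRange.inner_mk, ← hCA',
      P.adjoint_pairing]
  have hST : ∀ u v, inner ℂ (S u) v = inner ℂ u (T v) := fun u v => by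
    rw [← inner_conj_symm, ← hTS, inner_conj_symm]
  -- The radius `r` may be negative if the spectrum is empty, hence `max r 0` below.
  obtain ⟨r, hr⟩ := hspec.subset_closedBall 0
  obtain ⟨M, hM, hbound⟩ := exists_bound_of_surjective (S ∘ₗ T)
    (fun u v => by simp only [LinearMap.comp_apply, hST, hTS])
    (fun u => by
      rw [LinearMap.comp_apply, hST]
      exact inner_self_nonneg (𝕜 := ℂ)) (le_max_right r 0) fun s hs u => by
    obtain ⟨x, rfl⟩ := AntiDualPair.EnergyRange.exists_mk_eq hA u
    -- Solve `s • z - B (C z) = x` in `dom A`; applying `A` turns this into `s • A z - S (T (A z)) =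
    -- A x`.
    obtain ⟨z, rfl⟩ := exists_smul_sub_apply_eq_of_notMem_spectrum (c := (s : ℂ)) (fun hmem => by
      have h1 := hr hmem
      rw [mem_closedBall_zero_iff, Complex.norm_real, Real.norm_eq_abs] at h1
      exact absurd hs (h1.trans (le_max_left r 0)).not_gt) x
    refine ⟨AntiDualPair.EnergyRange.mk hA z, ?_⟩
    rw [LinearMap.comp_apply, hT, hS, AntiDualPair.EnergyRange.sub_mk]
    rfl
  obtain ⟨hSb, hTb⟩ := exists_bounds_of_comp_bounded hST hM hbound
  exact ⟨AntiDualPair.adjoint_comp_kreinVonNeumann hP hA (hB := hB) (S := S.mkContinuous _ hSb)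
      (T := T.mkContinuous _ hTb) (fun _ => rfl) (fun _ => rfl) hST,
    AntiDualPair.adjoint_comp_kreinVonNeumann hP hA (hB := hC) (S := T.mkContinuous _ hTb)
      (T := S.mkContinuous _ hSb) (fun _ => rfl) (fun _ => rfl) hTS⟩
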